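/- Let $k,q\ge 1$ be integers. Let $W_{k,q}=\{\mathbf v\in\mathbb Z^{k-1}: 0\le v_1\le v_2\le\cdots\le v_{k-1}\le q\}$, and let $T_{k,q}$ (the edgewise subdivision of the $(k-1)$-simplex $\{\mathbf x\in\mathbb R^{k-1}:0\le x_1\le\cdots\le x_{k-1}\le q\}$) be the simplicial complex with vertex set $W_{k,q}$ whose facets are the sets $$F(\mathbf v,\pi)=\{\mathbf v,\ \mathbf v+e_{\pi_{k-1}},\ \mathbf v+e_{\pi_{k-1}}+e_{\pi_{k-2}},\ \dots,\ \mathbf v+e_{\pi_{k-1}}+\cdots+e_{\pi_1}=\mathbf v+\mathbb 1\},$$ where $\mathbf v$ and $\mathbf v+\mathbb 1$ belong to $W_{k,q}$ and $\pi=\pi_1\cdots\pi_{k-1}$ is a permutation of $\{1,\dots,k-1\}$ in which $i$ stands before $i+1$ whenever $v_i=v_{i+1}$. The link of a vertex $\mathbf v$ of a complex $T$ is $\{\tau\in T:\mathbf v\notin\tau,\ \tau\cup\{\mathbf v\}\in T\}$, and two complexes are combinatorially equivalent if some bijection of their vertex sets carries the faces of one exactly onto the faces of the other. For $s\ge1$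 let $\mathrm{Par}(k,s)$ be the set of partitions of $k$ into exactly $s$ parts, $p_{k,s}=|\mathrm{Par}(k,s)|$, and let $p_k$ be the number of all partitions of $k$. For a partition $\lambda=(\lambda_1\ge\cdots\ge\lambda_s)$ of $k$ let $P_\lambda=C_{\lambda_1}\times\cdots\times C_{\lambda_s}$, where $C_m$ is the chain $0<1<\cdots<m$, and let $K_\lambda$ be the reduced order complex of $P_\lambda$, that is, the complex of all finite chains of $P_\lambda\setminus\{\hat 0,\hat 1\}$. Then, up to combinatorial equivalence, the links of the vertices of $T_{k,q}$ are exactly the complexes $K_\lambda$ with $\lambda\in\bigcup_{s=1}^{q}\mathrm{Par}(k,s)$: the link of every vertex is combinatorially equivalent to such a $K_\lambda$, and every such $K_\lambda$ is combinatorially equivalent to the link of some vertex. Moreover, the number of combinatorially different links of vertices of $T_{k,q}$ is $p_k$ if $q\ge k$, and $p_{k,1}+p_{k,2}+\cdots+p_{k,q}$ if $q<k$. -/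

import Mathlib

namespace PreAbstractSimplicialComplex

/-- The vertex set of a simplicial complex: the points that are faces. -/
def vertices {α : Type*} (K : PreAbstractSimplicialComplex α) : Set α :=
  {a | {a} ∈ K.faces}

/-- The link of `σ` in `K`: the faces `τ` that are disjoint from `σ` and such that `σ ∪ τ` is
again a face. (Only nonempty faces are listed, as everywhere in Mathlib.) -/
def link {α : Type*} [DecidableEq α] (K : PreAbstractSimplicialComplex α) (σ : Finset α) :
    PreAbstractSimplicialComplex α where
  faces := {τ | τ ∈ K.faces ∧ σ ∪ τ ∈ K.faces ∧ Disjoint σ τ}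
  isRelLowerSet_faces := by
    rintro τ ⟨h1, h2, h3⟩
    refine ⟨(K.isRelLowerSet_faces h1).1, fun ρ hρ hne => ⟨?_, ?_, ?_⟩⟩
    · exact (K.isRelLowerSet_faces h1).2 hρ hne
    · exact (K.isRelLowerSet_faces h2).2 (Finset.union_subset_union_right hρ)
        (hne.mono Finset.subset_union_right)
    · exact h3.mono_right hρ

/-- Combinatorial equivalence of simplicial complexes: a bijection between the vertex sets under
which faces correspond to faces, in both directions. -/
def Iso {α β : Type*} (K : PreAbstractSimplicialComplex α) (L : PreAbstractSimplicialComplex β) :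
    Prop :=
  ∃ f : K.vertices ≃ L.vertices, ∀ s : Finset K.vertices,
    s.map (Function.Embedding.subtype _) ∈ K.faces ↔
      (s.map f.toEmbedding).map (Function.Embedding.subtype _) ∈ L.faces

theorem Iso.refl {α : Type*} (K : PreAbstractSimplicialComplex α) : K.Iso K :=
  ⟨Equiv.refl _, fun s => by simp⟩

theorem Iso.symm {α β : Type*} {K : PreAbstractSimplicialComplex α}
    {L : PreAbstractSimplicialComplex β} (h : K.Iso L) : L.Iso K := by
  obtain ⟨f, hf⟩ := h
  refine ⟨f.symm, fun s => ?_⟩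
  have h1 := hf (s.map f.symm.toEmbedding)
  rw [h1, Finset.map_map (f := f.symm.toEmbedding)]
  have h2 : f.symm.toEmbedding.trans f.toEmbedding = Function.Embedding.refl _ := by
    ext x; simp
  rw [h2, Finset.map_refl]

theorem Iso.trans {α β γ : Type*} {K : PreAbstractSimplicialComplex α}
    {L : PreAbstractSimplicialComplex β} {M : PreAbstractSimplicialComplex γ}
    (h : K.Iso L) (h' : L.Iso M) : K.Iso M := by
  obtain ⟨f, hf⟩ := h
  obtain ⟨g, hg⟩ := h'
  refine ⟨f.trans g, fun s => ?_⟩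
  rw [hf s, hg (s.map f.toEmbedding), Finset.map_map (f := f.toEmbedding)]
  rfl

/-- Combinatorial equivalence as an equivalence relation; its classes are the combinatorial types
of complexes. -/
def isoSetoid (α : Type*) : Setoid (PreAbstractSimplicialComplex α) where
  r := Iso
  iseqv := ⟨Iso.refl, Iso.symm, Iso.trans⟩

end PreAbstractSimplicialComplex

namespace EdgewiseSubdivision

/-- The integer points `0 ≤ v₁ ≤ ⋯ ≤ v_{k-1} ≤ q` of the simplex `R_{k,q}`. -/
def W (k q : ℕ) : Set (Fin (k - 1) → ℤ) :=
  {v | (∀ i, 0 ≤ v i ∧ v i ≤ (q : ℤ)) ∧ Monotone v}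

/-- The permutation `π = π₁ ⋯ π_{k-1}` is consistent with `v`: `i` stands before `i + 1` in `π`
whenever `v i = v (i + 1)`. (The position of `i` in `π` is `π.symm i`.) -/
def Consistent {k : ℕ} (v : Fin (k - 1) → ℤ) (π : Equiv.Perm (Fin (k - 1))) : Prop :=
  ∀ i j : Fin (k - 1), (j : ℕ) = i + 1 → v i = v j → π.symm i < π.symm j

/-- The vertex obtained from `v` by adding `1` to the coordinates that stand in the last `j`
positions of `π`: the point `v + e_{π_{k-1}} + ⋯ + e_{π_{k-j}}`. -/
def facetVertex {k : ℕ} (v : Fin (k - 1) → ℤ) (π : Equiv.Perm (Fin (k - 1))) (j : ℕ) :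
    Fin (k - 1) → ℤ :=
  fun i => v i + if k - 1 ≤ (π.symm i : ℕ) + j then 1 else 0

/-- The vertex set of the facet `F(v, π)`. -/
def facet {k : ℕ} (v : Fin (k - 1) → ℤ) (π : Equiv.Perm (Fin (k - 1))) :
    Finset (Fin (k - 1) → ℤ) :=
  (Finset.range k).image (facetVertex v π)

/-- The edgewise subdivision `T_{k,q}` of the simplex `R_{k,q}`, as an abstract simplicial
complex: its faces are the nonempty subsets of the facets `F(v, π)`, where `v` and `v + 𝟙` (the
first and the last vertex of the facet) lie in `R_{k,q}` and `π` is consistent with `v`. -/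
def T (k q : ℕ) : PreAbstractSimplicialComplex (Fin (k - 1) → ℤ) where
  faces := {s | s.Nonempty ∧ ∃ (v : Fin (k - 1) → ℤ) (π : Equiv.Perm (Fin (k - 1))),
    v ∈ W k q ∧ v + 1 ∈ W k q ∧ Consistent v π ∧ s ⊆ facet v π}
  isRelLowerSet_faces := by
    rintro s ⟨hs, v, π, h1, h2, h3, h4⟩
    exact ⟨hs, fun t ht hne => ⟨hne, v, π, h1, h2, h3, ht.trans h4⟩⟩

/-- The vertex set of `T_{k,q}` is `W_{k,q}`. -/
theorem vertices_T {k q : ℕ} (hk : 1 ≤ k) (hq : 1 ≤ q) : (T k q).vertices = W k q := by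
  ext v
  constructor
  · rintro ⟨-, u, π, ⟨hu, hm⟩, ⟨hu', -⟩, hc, hs⟩
    rw [Finset.singleton_subset_iff, facet, Finset.mem_image] at hs
    obtain ⟨j, -, rfl⟩ := hs
    refine ⟨fun i => ?_, ?_⟩
    · have h1 := hu i
      have h2 := hu' i
      simp only [Pi.add_apply, Pi.one_apply] at h2
      unfold facetVertex
      split_ifs <;> omega
    · have key : ∀ n : ℕ, ∀ a b : Fin (k - 1), (b : ℕ) = a + n →
          facetVertex u π j a ≤ facetVertex u π j b := by
        intro n
        induction n with
        | zero =>
          intro a b hab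
          have : a = b := Fin.ext (by omega)
          rw [this]
        | succ n ih =>
          intro a b hab
          have hlt : (a : ℕ) + n < k - 1 := by have := b.2; omega
          refine (ih a ⟨a + n, hlt⟩ rfl).trans ?_
          have h1 : u ⟨a + n, hlt⟩ ≤ u b := hm (Fin.mk_le_of_le_val (by omega))
          have h2 := hc ⟨a + n, hlt⟩ b (by simp; omega)
          unfold facetVertex
          rcases h1.lt_or_eq with h | h
          · split_ifs <;> omega
          · have h3 : (π.symm ⟨a + n, hlt⟩ : ℕ) < π.symm b := h2 h
            split_ifs <;> omega
      intro a b hab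
      exact key (b - a) a b (by have : (a : ℕ) ≤ b := hab; omega)
  · rintro ⟨hv, hm⟩
    have hj : ∃ j, j < k ∧ ∀ i : Fin (k - 1), v i = (q : ℤ) ↔ k - 1 ≤ (i : ℕ) + j := by
      by_cases he : ∃ i, v i = (q : ℤ)
      · obtain ⟨i, hi, hmin⟩ := WellFounded.has_min wellFounded_lt {i | v i = (q : ℤ)} he
        refine ⟨k - 1 - i, by omega, fun a => ⟨fun ha => ?_, fun ha => ?_⟩⟩
        · have : ¬ a < i := hmin a ha
          have : (i : ℕ) ≤ a := not_lt.mp this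
          omega
        · have h1 : i ≤ a := Fin.le_def.mpr (by have := i.2; omega)
          have h2 := hm h1
          have h3 := (hv a).2
          have h4 : v i = (q : ℤ) := hi
          omega
      · push Not at he
        exact ⟨0, by omega, fun a => ⟨fun ha => (he a ha).elim, fun ha => by
          have := a.2; omega⟩⟩
    obtain ⟨j, hjk, hj⟩ := hj
    refine ⟨Finset.singleton_nonempty _, fun i => v i - if v i = (q : ℤ) then 1 else 0, 1,
      ⟨fun i => ?_, fun a b hab => ?_⟩, ⟨fun i => ?_, fun a b hab => ?_⟩, ?_, ?_⟩
    · have := hv i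
      dsimp only
      split_ifs <;> omega
    · have h1 := hm hab
      have h2 := hv b
      dsimp only
      split_ifs <;> omega
    · have := hv i
      simp only [Pi.add_apply, Pi.one_apply]
      split_ifs <;> omega
    · have h1 := hm hab
      have h2 := hv b
      simp only [Pi.add_apply, Pi.one_apply]
      split_ifs <;> omega
    · intro a b hab _
      show a < b
      exact Fin.lt_def.mpr (by omega)
    · rw [Finset.singleton_subset_iff, facet, Finset.mem_image]
      refine ⟨j, Finset.mem_range.mpr hjk, ?_⟩
      funext i
      have h1 := hj i
      have h2 : (((1 : Equiv.Perm (Fin (k - 1))).symm i : Fin (k - 1)) : ℕ) = i := rfl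
      unfold facetVertex
      rw [h2]
      beta_reduce
      by_cases h : v i = (q : ℤ)
      · rw [if_pos h, if_pos (h1.mp h)]; ring
      · rw [if_neg h, if_neg (fun h' => h (h1.mpr h'))]; ring

/-- The order complex of a partially ordered set: its faces are the nonempty finite chains. -/
def orderComplex (P : Type*) [PartialOrder P] : PreAbstractSimplicialComplex P where
  faces := {s | s.Nonempty ∧ IsChain (· ≤ ·) (s : Set P)}
  isRelLowerSet_faces := by
    rintro s ⟨hs, hc⟩
    exact ⟨hs, fun t ht hne => ⟨hne, hc.mono (Finset.coe_subset.mpr ht)⟩⟩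

/-- A bounded partially ordered set without its minimum and its maximum. -/
abbrev Proper (P : Type*) [PartialOrder P] [BoundedOrder P] : Type _ :=
  {x : P // x ≠ ⊥ ∧ x ≠ ⊤}

/-- The product `C_{m₁} × ⋯ × C_{mₛ}` of chains, where `C_m = {0 < 1 < ⋯ < m}` is the chain of
length `m`, with the componentwise order. -/
abbrev ProductOfChains (m : List ℕ) : Type :=
  ∀ i : Fin m.length, Fin (m.get i + 1)

/-- The parts `λ₁ ≥ λ₂ ≥ ⋯ ≥ λₛ` of a partition in decreasing order. -/
def sortedParts {k : ℕ} (p : k.Partition) : List ℕ :=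
  p.parts.sort (· ≥ ·)

/-- The complex `K_λ` of a partition `λ = (λ₁, …, λₛ)`: the reduced order complex of
`C_{λ₁} × ⋯ × C_{λₛ}`. -/
def K {k : ℕ} (p : k.Partition) :
    PreAbstractSimplicialComplex (Proper (ProductOfChains (sortedParts p))) :=
  orderComplex _

/-- `Par(k, s)`: the partitions of `k` into exactly `s` parts. -/
def Par (k s : ℕ) : Set k.Partition :=
  {p | p.parts.card = s}

/-- The number of combinatorially different links of vertices of `T_{k,q}`. -/
noncomputable def numLinkTypes (k q : ℕ) : ℕ :=
  ((fun v => (Quotient.mk (PreAbstractSimplicialComplex.isoSetoid _) ((T k q).link {v}))) ''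
    (T k q).vertices).ncard

end EdgewiseSubdivision

/-! `T k q` is a flag complex: its faces are the nonempty cliques of the graph on `W k q` that joins
two points when their difference, in one of the two orders, is a 0/1-vector (`T_isCliqueComplex`). A
link is then the clique complex on the neighbours of the vertex.

Add a coordinate `none` of value 0 and work modulo the all-ones vector. The neighbours of `v` become
sets `S` of raised coordinates, nonempty and proper among the `k` coordinates, and adjacency becomes
comparability under inclusion (`adj_shift`). The inequalities defining `W k q` are cyclic, 0 ≤ v₁ ≤
⋯ ≤ v_{k-1} ≤ 0 + q, and a unit raise can violate only those that are equalities at `v`. Hence `S`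
is admissible iff it is upward closed inside each class of coordinates congruent modulo `q`
(`shift_mem_W`). Such sets form a product of chains whose lengths are the class sizes
(`exists_orderIso_classUpper`). These sizes are a partition of `k` into at most `q` parts, and every
such partition occurs.

Different partitions give different complexes. `K_λ` determines the comparability graph of `P_λ`,
hence its number of `n`-element multichains, ∏ (λᵢ + n choose n). As a polynomial in `n` this has
the root -(j+1) with multiplicity #{i : λᵢ > j}. These multiplicities form the conjugate partition
and so determine λ (`eq_of_prod_choose_eq`). -/

namespace PreAbstractSimplicialComplex

/-! ### Clique complexes -/

/-- A complex is the clique complex of the relation `r` on the set `V`. -/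
def IsCliqueComplex {α : Type*} (K : PreAbstractSimplicialComplex α) (V : Set α)
    (r : α → α → Prop) : Prop :=
  ∀ s : Finset α, s ∈ K.faces ↔ s.Nonempty ∧ (∀ x ∈ s, x ∈ V) ∧ ∀ x ∈ s, ∀ y ∈ s, r x y

theorem IsCliqueComplex.vertices_eq {α : Type*} {K : PreAbstractSimplicialComplex α} {V : Set α}
    {r : α → α → Prop} (h : K.IsCliqueComplex V r) (hr : ∀ x ∈ V, r x x) : K.vertices = V := by
  ext x
  have := h {x}
  simp only [Finset.singleton_nonempty, Finset.mem_singleton, forall_eq, true_and] at this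
  exact this.trans ⟨fun h => h.1, fun h => ⟨h, hr x h⟩⟩

/-- Clique complexes are combinatorially equivalent if their graphs are isomorphic. -/
theorem IsCliqueComplex.iso {α β : Type*} {K : PreAbstractSimplicialComplex α}
    {L : PreAbstractSimplicialComplex β} {V : Set α} {r : α → α → Prop} {r' : β → β → Prop}
    (hK : K.IsCliqueComplex V r) (hL : L.IsCliqueComplex Set.univ r')
    (hr : ∀ x ∈ V, r x x) (hr' : ∀ x, r' x x) (f : β → α) (hf : Function.Injective f)
    (hV : Set.range f = V) (hadj : ∀ x y, r (f x) (f y) ↔ r' x y) : K.Iso L := by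
  refine Iso.symm ?_
  have e1 := hK.vertices_eq hr
  have e2 := hL.vertices_eq (fun x _ => hr' x)
  let F : L.vertices → K.vertices := fun x => ⟨f x, by rw [e1, ← hV]; exact ⟨x, rfl⟩⟩
  have hF : Function.Bijective F := by
    refine ⟨fun x y hxy => Subtype.ext (hf (congrArg Subtype.val hxy)), ?_⟩
    rintro ⟨y, hy⟩
    have hy' := hy
    rw [e1, ← hV] at hy'
    obtain ⟨x, rfl⟩ := hy'
    exact ⟨⟨x, by rw [e2]; trivial⟩, rfl⟩
  refine ⟨Equiv.ofBijective F hF, fun s => ?_⟩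
  rw [hL, hK]
  refine and_congr (by simp) (and_congr ?_ ?_)
  · simp only [Set.mem_univ, implies_true, true_iff]
    intro x hx
    rw [Finset.mem_map] at hx
    obtain ⟨y, -, rfl⟩ := hx
    rw [← e1]
    exact y.2
  · simp only [Finset.mem_map, forall_exists_index, and_imp, forall_apply_eq_imp_iff₂]
    exact forall₂_congr fun a _ => forall₂_congr fun b _ => (hadj a b).symm

end PreAbstractSimplicialComplex

namespace EdgewiseSubdivision

open PreAbstractSimplicialComplex

/-! ### The subdivision and its links as clique complexes -/

/-- Two integer points of a cube `u + {0,1}ⁿ` that are comparable. -/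
def Adj {n : ℕ} (x y : Fin n → ℤ) : Prop :=
  (x ≤ y ∧ y ≤ x + 1) ∨ (y ≤ x ∧ x ≤ y + 1)

theorem Adj.refl {n : ℕ} (x : Fin n → ℤ) : Adj x x :=
  Or.inl ⟨le_rfl, fun i => by simp⟩

theorem adj_facetVertex {k : ℕ} (v : Fin (k - 1) → ℤ) (π : Equiv.Perm (Fin (k - 1))) (a b : ℕ) :
    Adj (facetVertex v π a) (facetVertex v π b) := by
  rcases le_total a b with h | h
  · refine Or.inl ⟨fun i => ?_, fun i => ?_⟩ <;>
    · simp only [facetVertex, Pi.add_apply, Pi.one_apply]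
      split_ifs <;> omega
  · refine Or.inr ⟨fun i => ?_, fun i => ?_⟩ <;>
    · simp only [facetVertex, Pi.add_apply, Pi.one_apply]
      split_ifs <;> omega

/-- A nested family of `0/1`-perturbations `v + 1_S` of `v` that are all monotone lies in a
single facet `F(v, π)`. -/
theorem exists_subset_facet {k : ℕ} (hk : 1 ≤ k) (v : Fin (k - 1) → ℤ)
    (s : Finset (Fin (k - 1) → ℤ)) (hmono : ∀ x ∈ s, Monotone x)
    (h01 : ∀ x ∈ s, v ≤ x ∧ x ≤ v + 1) (htot : ∀ x ∈ s, ∀ y ∈ s, x ≤ y ∨ y ≤ x) :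
    ∃ π, Consistent v π ∧ s ⊆ facet v π := by
  classical
  -- `lev i` counts the points of `s` that raise coordinate `i`. Sorting by it puts the coordinates
  -- raised by any one point last; the stable tie-breaking of `Tuple.sort` gives consistency.
  let lev : Fin (k - 1) → ℕ := fun i => (s.filter fun x => v i < x i).card
  let π := Tuple.sort lev
  have hπ1 : Monotone (lev ∘ π) := Tuple.monotone_sort lev
  have hπ2 := (Tuple.eq_sort_iff (f := lev) (σ := π)).mp rfl |>.2
  have lt_of : ∀ i j, lev i < lev j → π.symm i < π.symm j := by
    intro i j h
    by_contra hc
    have := hπ1 (not_lt.mp hc)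
    simp only [Function.comp_apply, Equiv.apply_symm_apply] at this
    omega
  refine ⟨π, ?_, ?_⟩
  · intro i j hij hv
    have hle : lev i ≤ lev j := by
      refine Finset.card_le_card fun x hx => ?_
      rw [Finset.mem_filter] at hx ⊢
      have := hmono x hx.1 (show i ≤ j from Fin.le_def.mpr (by omega))
      exact ⟨hx.1, by omega⟩
    rcases hle.lt_or_eq with h | h
    · exact lt_of i j h
    · by_contra hc
      have hne : i ≠ j := fun h => by subst h; omega
      have hlt : π.symm j < π.symm i := lt_of_le_of_ne (not_lt.mp hc)
        fun h => hne (π.symm.injective h).symm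
      have := hπ2 _ _ hlt (by simpa using h.symm)
      simp only [Equiv.apply_symm_apply] at this
      have := Fin.lt_def.mp this
      omega
  · intro x hx
    -- As `s` is a chain, every point raising `j` also raises `i`, while `x` raises only `i`; so
    -- `lev j < lev i`.
    have hup : ∀ i j, v i < x i → ¬ v j < x j → π.symm j < π.symm i := by
      intro i j hi hj
      apply lt_of
      refine Finset.card_lt_card ⟨fun y hy => ?_, fun hsub => ?_⟩
      · rw [Finset.mem_filter] at hy ⊢
        refine ⟨hy.1, ?_⟩
        rcases htot x hx y hy.1 with h | h
        · exact hi.trans_le (h i)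
        · exact absurd (hy.2.trans_le (h j)) hj
      · have := hsub (Finset.mem_filter.mpr ⟨hx, hi⟩)
        exact hj (Finset.mem_filter.mp this).2
    -- `j` is the number of coordinates raised by `x`, that is `k - 1 - p` for the first raised
    -- position `p`.
    have hj : ∃ j, j < k ∧ ∀ i, v i < x i ↔ k - 1 ≤ (π.symm i : ℕ) + j := by
      by_cases he : ∃ p, v (π p) < x (π p)
      · obtain ⟨p, hp, hmin⟩ := WellFounded.has_min wellFounded_lt {p | v (π p) < x (π p)} he
        refine ⟨k - 1 - p, by omega, fun i => ⟨fun hi => ?_, fun hi => ?_⟩⟩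
        · have : ¬ π.symm i < p := hmin (π.symm i) (by simpa using hi)
          have : (p : ℕ) ≤ π.symm i := not_lt.mp this
          omega
        · by_contra hc
          have := hup (π p) i hp hc
          rw [Equiv.symm_apply_apply] at this
          have := Fin.lt_def.mp this
          have := p.2
          omega
      · refine ⟨0, by omega, fun i => ⟨fun hi => ?_, fun hi => ?_⟩⟩
        · exact absurd ⟨π.symm i, by simpa using hi⟩ he
        · have := (π.symm i).2
          omega
    obtain ⟨j, hjk, hj⟩ := hj
    rw [facet, Finset.mem_image]
    refine ⟨j, Finset.mem_range.mpr hjk, funext fun i => ?_⟩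
    have h1 : v i ≤ x i := (h01 x hx).1 i
    have h2 : x i ≤ v i + 1 := (h01 x hx).2 i
    have h3 := hj i
    unfold facetVertex
    split_ifs with h <;> omega

/-- A minimal point `m` of a clique lies below all others, so the clique is a chain in the cube from
`m` to `m + 1`, and `exists_subset_facet` applies once the base point is adjusted. -/
theorem T_isCliqueComplex {k q : ℕ} (hk : 1 ≤ k) (hq : 1 ≤ q) :
    (T k q).IsCliqueComplex (W k q) Adj := by
  intro s
  constructor
  · intro hs
    refine ⟨hs.1, fun x hx => ?_, ?_⟩
    · rw [← vertices_T hk hq]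
      exact ((T k q).isRelLowerSet_faces hs).2 (Finset.singleton_subset_iff.mpr hx)
        (Finset.singleton_nonempty x)
    · obtain ⟨-, v, π, -, -, -, hsub⟩ := hs
      intro x hx y hy
      obtain ⟨a, -, rfl⟩ := Finset.mem_image.mp (hsub hx)
      obtain ⟨b, -, rfl⟩ := Finset.mem_image.mp (hsub hy)
      exact adj_facetVertex v π a b
  · rintro ⟨hne, hW, hadj⟩
    obtain ⟨m, hm, hmin⟩ := s.exists_minimal hne
    have hm' : ∀ x ∈ s, m ≤ x ∧ x ≤ m + 1 := by
      intro x hx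
      rcases hadj m hm x hx with h | h
      · exact h
      · have : m ≤ x := hmin hx h.1
        obtain rfl := le_antisymm this h.1
        exact ⟨le_rfl, h.2⟩
    have hmW := hW m hm
    -- `m + 1` leaves `W k q` where `m` equals `q`. No point of the clique can be raised there, so
    -- the base is lowered by 1 at these coordinates.
    let u : Fin (k - 1) → ℤ := fun i => m i - if m i = (q : ℤ) then 1 else 0
    have h01 : ∀ x ∈ s, u ≤ x ∧ x ≤ u + 1 := by
      refine fun x hx => ⟨fun i => ?_, fun i => ?_⟩
      · have h1 : m i ≤ x i := (hm' x hx).1 i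
        simp only [u]
        split_ifs <;> omega
      · have h1 : x i ≤ m i + 1 := (hm' x hx).2 i
        have h2 := ((hW x hx).1 i).2
        simp only [u, Pi.add_apply, Pi.one_apply]
        split_ifs <;> omega
    obtain ⟨π, hc, hsub⟩ := exists_subset_facet hk u s (fun x hx => (hW x hx).2) h01
      (fun x hx y hy => (hadj x hx y hy).imp And.left And.left)
    refine ⟨hne, u, π, ⟨fun i => ?_, fun a b hab => ?_⟩, ⟨fun i => ?_, fun a b hab => ?_⟩,
      hc, hsub⟩
    · have := hmW.1 i
      simp only [u]
      split_ifs <;> omega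
    · have h1 := hmW.2 hab
      have h2 := hmW.1 b
      simp only [u]
      split_ifs <;> omega
    · have := hmW.1 i
      simp only [u, Pi.add_apply, Pi.one_apply]
      split_ifs <;> omega
    · have h1 := hmW.2 hab
      have h2 := hmW.1 b
      simp only [u, Pi.add_apply, Pi.one_apply]
      split_ifs <;> omega

theorem link_isCliqueComplex {k q : ℕ} (hk : 1 ≤ k) (hq : 1 ≤ q) {v : Fin (k - 1) → ℤ}
    (hv : v ∈ W k q) :
    ((T k q).link {v}).IsCliqueComplex {w | w ∈ W k q ∧ w ≠ v ∧ Adj v w} Adj := by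
  intro s
  have hT := T_isCliqueComplex hk hq
  change s ∈ (T k q).faces ∧ {v} ∪ s ∈ (T k q).faces ∧ Disjoint {v} s ↔ _
  rw [hT, hT]
  constructor
  · rintro ⟨⟨h1, h2, h3⟩, ⟨-, -, h4⟩, h5⟩
    refine ⟨h1, fun x hx => ⟨h2 x hx, ?_, h4 v (by simp) x (by simp [hx])⟩, h3⟩
    rintro rfl
    simp [hx] at h5
  · rintro ⟨h1, h2, h3⟩
    have hsymm : ∀ x ∈ s, Adj x v := fun x hx => (h2 x hx).2.2.symm
    refine ⟨⟨h1, fun x hx => (h2 x hx).1, h3⟩, ⟨by simp, ?_, ?_⟩, ?_⟩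
    · intro x hx
      rcases Finset.mem_union.mp hx with h | h
      · rwa [Finset.mem_singleton.mp h]
      · exact (h2 x h).1
    · intro x hx y hy
      rcases Finset.mem_union.mp hx with h | h <;> rcases Finset.mem_union.mp hy with h' | h'
      · rw [Finset.mem_singleton.mp h, Finset.mem_singleton.mp h']
        exact Adj.refl v
      · rw [Finset.mem_singleton.mp h]
        exact (h2 y h').2.2
      · rw [Finset.mem_singleton.mp h']
        exact hsymm x h
      · exact h3 x h y h'
    · rw [Finset.disjoint_singleton_left]
      exact fun h => (h2 v h).2.1 rfl

theorem orderComplex_isCliqueComplex (P : Type*) [PartialOrder P] :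
    (orderComplex P).IsCliqueComplex Set.univ (fun x y => x ≤ y ∨ y ≤ x) := by
  intro s
  refine and_congr Iff.rfl ⟨fun h => ⟨fun _ _ => trivial, fun x hx y hy => h.total hx hy⟩,
    fun h x hx y hy _ => h.2 x hx y hy⟩

/-! ### Class-wise upper sets as a product of chains -/

/-- The sets that are upward closed, with respect to `key`, inside every class of `cls`. -/
def ClassUpper {E ι : Type*} (key : E → ℤ) (cls : E → ι) (S : Finset E) : Prop :=
  ∀ e e', cls e = cls e' → key e ≤ key e' → e ∈ S → e' ∈ S

/-- Elements are added greedily in order of decreasing key. This makes the cardinality map in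
`exists_orderIso_classUpper` surjective. -/
theorem exists_upper_subset_card {E : Type*} [DecidableEq E] (key : E → ℤ)
    (hkey : Function.Injective key) (C : Finset E) (t : ℕ) (ht : t ≤ C.card) :
    ∃ A ⊆ C, A.card = t ∧ ∀ e ∈ C, ∀ e' ∈ C, key e ≤ key e' → e ∈ A → e' ∈ A := by
  induction t with
  | zero => exact ⟨∅, by simp⟩
  | succ t ih =>
    obtain ⟨A, hA, hcard, hup⟩ := ih (by omega)
    have hne : (C \ A).Nonempty := by
      rw [← Finset.card_pos, Finset.card_sdiff_of_subset hA]
      omega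
    obtain ⟨a, ha, hmax⟩ := Finset.exists_max_image (C \ A) key hne
    rw [Finset.mem_sdiff] at ha
    refine ⟨insert a A, Finset.insert_subset ha.1 hA, ?_, ?_⟩
    · rw [Finset.card_insert_of_notMem ha.2, hcard]
    · intro e he e' he' hle hmem
      rw [Finset.mem_insert] at hmem ⊢
      rcases hmem with rfl | hmem
      · by_cases h : e' ∈ A
        · exact Or.inr h
        · exact Or.inl (hkey (le_antisymm (hmax e' (Finset.mem_sdiff.mpr ⟨he', h⟩)) hle))
      · exact Or.inr (hup e he e' he' hle hmem)

/-- The lattice of class-wise upper sets is a product of chains. -/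
theorem exists_orderIso_classUpper {E ι : Type*} [Fintype E] [DecidableEq E] [DecidableEq ι]
    (key : E → ℤ) (hkey : Function.Injective key) (cls : E → ι) (m : ι → ℕ)
    (hm : ∀ c, (Finset.univ.filter fun e => cls e = c).card = m c) :
    Nonempty ({S : Finset E // ClassUpper key cls S} ≃o ∀ c, Fin (m c + 1)) := by
  let f : {S : Finset E // ClassUpper key cls S} → ∀ c, Fin (m c + 1) := fun S c =>
    ⟨(S.1.filter fun e => cls e = c).card, Nat.lt_succ_of_le (by
      rw [← hm c]
      exact Finset.card_le_card (Finset.filter_subset_filter _ (Finset.subset_univ _)))⟩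
  -- Inside one class the upper sets are nested, so cardinality decides inclusion.
  have hf : ∀ S S', f S ≤ f S' ↔ S ≤ S' := by
    intro S S'
    constructor
    · intro h e he
      by_contra he'
      have h1 : (S.1.filter fun x => cls x = cls e).card ≤
        (S'.1.filter fun x => cls x = cls e).card := h (cls e)
      refine absurd h1 (not_le.mpr (Finset.card_lt_card ⟨fun x hx => ?_, fun hsub => ?_⟩))
      · rw [Finset.mem_filter] at hx ⊢
        refine ⟨?_, hx.2⟩
        rcases le_total (key x) (key e) with hle | hle
        · exact absurd (S'.2 x e hx.2 hle hx.1) he'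
        · exact S.2 e x hx.2.symm hle he
      · exact he' (Finset.mem_filter.mp (hsub (Finset.mem_filter.mpr ⟨he, rfl⟩))).1
    · intro h c
      exact Finset.card_le_card (Finset.filter_subset_filter _ h)
  have hsurj : Function.Surjective f := by
    intro t
    choose A hA hcard hup using fun c => exists_upper_subset_card key hkey
      (Finset.univ.filter fun e => cls e = c) (t c) (by
        rw [hm c]
        exact Nat.lt_succ_iff.mp (t c).2)
    refine ⟨⟨Finset.univ.filter fun e => e ∈ A (cls e), ?_⟩, funext fun c => Fin.ext ?_⟩
    · intro e e' hc hle he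
      simp only [Finset.mem_filter, Finset.mem_univ, true_and] at he ⊢
      rw [← hc]
      exact hup (cls e) e (by simp) e' (by simp [hc]) hle he
    · rw [← hcard c]
      change Finset.card _ = _
      congr 1
      ext e
      simp only [Finset.mem_filter, Finset.mem_univ, true_and]
      constructor
      · rintro ⟨h, rfl⟩
        exact h
      · intro h
        have := (Finset.mem_filter.mp (hA c h)).2
        subst this
        exact ⟨h, rfl⟩
  exact ⟨RelIso.ofSurjective (OrderEmbedding.ofMapLEIff f hf) hsurj⟩

/-! ### Neighbours of a vertex as sets of raised coordinates -/

/-- The residues modulo `q` of the coordinates of `v`, where `none` is an additional coordinate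
of value `0`. -/
def residue {k : ℕ} (q : ℕ) (v : Fin (k - 1) → ℤ) : Option (Fin (k - 1)) → ℤ
  | none => 0
  | some i => if v i = q then 0 else v i

/-- The cyclic order of the coordinates of `v`, cut before the first coordinate equal to `q`. -/
def cyclicKey {k : ℕ} (q : ℕ) (v : Fin (k - 1) → ℤ) : Option (Fin (k - 1)) → ℤ
  | none => 0
  | some i => if v i = q then (i : ℤ) + 1 - k else (i : ℤ) + 1

theorem cyclicKey_injective {k : ℕ} (q : ℕ) (v : Fin (k - 1) → ℤ) :
    Function.Injective (cyclicKey q v) := by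
  rintro (_ | i) (_ | j) h
  · rfl
  · have := j.2
    simp only [cyclicKey] at h
    split_ifs at h <;> omega
  · have := i.2
    simp only [cyclicKey] at h
    split_ifs at h <;> omega
  · have := i.2
    have := j.2
    simp only [cyclicKey] at h
    congr 1
    refine Fin.ext ?_
    split_ifs at h <;> omega

/-- Raise the coordinates of `v` in `S` by `1`; if the additional coordinate is raised too, then
lower all coordinates by `1`. -/
def shift {n : ℕ} (v : Fin n → ℤ) (S : Finset (Option (Fin n))) : Fin n → ℤ :=
  fun i => v i + (if some i ∈ S then 1 else 0) - (if none ∈ S then 1 else 0)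

theorem shift_empty {n : ℕ} (v : Fin n → ℤ) : shift v ∅ = v := by
  funext i
  simp [shift]

theorem adj_shift {n : ℕ} (v : Fin n → ℤ) (S S' : Finset (Option (Fin n))) :
    Adj (shift v S) (shift v S') ↔ S ⊆ S' ∨ S' ⊆ S := by
  have key : ∀ A B : Finset (Option (Fin n)), A ⊆ B → Adj (shift v A) (shift v B) := by
    intro A B h
    by_cases hn : none ∈ A ↔ none ∈ B
    · refine Or.inl ⟨fun i => ?_, fun i => ?_⟩ <;>
      · have := @h (some i)
        simp only [shift, Pi.add_apply, Pi.one_apply, hn]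
        split_ifs <;> first | omega | tauto
    -- If only the larger set contains `none`, the order of the two points is reversed: the larger
    -- set yields the smaller point.
    · have := @h none
      refine Or.inr ⟨fun i => ?_, fun i => ?_⟩ <;>
      · have := @h (some i)
        simp only [shift, Pi.add_apply, Pi.one_apply]
        split_ifs <;> first | omega | tauto
  have key' : ∀ A B : Finset (Option (Fin n)), shift v A ≤ shift v B →
      shift v B ≤ shift v A + 1 → A ⊆ B ∨ B ⊆ A := by
    intro A B h1 h2
    by_cases hn : none ∈ A → none ∈ B
    · by_cases hn' : none ∈ B → none ∈ A
      · refine Or.inl fun x hx => ?_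
        rcases x with _ | i
        · exact hn hx
        · have := h1 i
          simp only [shift, hx, if_true] at this
          split_ifs at this <;> first | assumption | omega | tauto
      · push Not at hn'
        refine Or.inl fun x hx => ?_
        rcases x with _ | i
        · exact hn hx
        · have := h1 i
          simp only [shift, hx, hn', if_true, if_false] at this
          split_ifs at this <;> first | assumption | omega
    · push Not at hn
      refine Or.inr fun x hx => ?_
      rcases x with _ | i
      · exact absurd hx hn.2
      · have := h2 i
        simp only [shift, Pi.add_apply, Pi.one_apply, hx, hn, if_true, if_false] at this
        split_ifs at this <;> first | assumption | omega
  refine ⟨?_, fun h => h.elim (key S S') fun h => (key S' S h).symm⟩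
  rintro (⟨h1, h2⟩ | ⟨h1, h2⟩)
  · exact key' S S' h1 h2
  · exact (key' S' S h1 h2).symm

/-- Raising every coordinate, `none` included, is the same as raising nothing; this is the only
coincidence, so excluding the full set suffices. -/
theorem shift_injOn {n : ℕ} (v : Fin n → ℤ) {S S' : Finset (Option (Fin n))}
    (hS : S ≠ Finset.univ) (hS' : S' ≠ Finset.univ) (h : shift v S = shift v S') : S = S' := by
  have key : ∀ A B : Finset (Option (Fin n)), A ≠ Finset.univ → shift v A = shift v B →
      none ∈ A → none ∈ B := by
    intro A B hA hAB hn
    by_contra hc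
    refine hA (Finset.eq_univ_iff_forall.mpr fun x => ?_)
    rcases x with _ | i
    · exact hn
    · have := congrFun hAB i
      simp only [shift, hn, hc, if_true, if_false] at this
      split_ifs at this <;> first | assumption | omega
  have hn : none ∈ S ↔ none ∈ S' := ⟨key S S' hS h, key S' S hS' h.symm⟩
  ext x
  rcases x with _ | i
  · exact hn
  · have := congrFun h i
    simp only [shift, hn] at this
    split_ifs at this <;> first | tauto | omega

/-- Only equalities of `v` matter. Equal neighbouring coordinates require that raising the earlier
one raises the later one. A coordinate equal to `q` can be raised only if `none` is, and raising
`none` forces raising the coordinates equal to 0. Thus in the class of residue 0 the order is: value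
`q`, then `none`, then value 0, as in `cyclicKey`. -/
theorem shift_mem_W {k q : ℕ} (hq : 1 ≤ q) {v : Fin (k - 1) → ℤ} (hv : v ∈ W k q)
    (S : Finset (Option (Fin (k - 1)))) :
    shift v S ∈ W k q ↔ ClassUpper (cyclicKey q v) (residue q v) S := by
  constructor
  · rintro ⟨h1, h2⟩ e e' hc hk he
    rcases e with _ | i <;> rcases e' with _ | j
    · exact he
    · have := hv.1 j
      have := h1 j
      have := j.2
      simp only [residue, cyclicKey, shift, he, if_true] at *
      split_ifs at * <;> first | assumption | omega
    · have := hv.1 i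
      have := h1 i
      have := i.2
      simp only [residue, cyclicKey, shift, he, if_true] at *
      split_ifs at * <;> first | assumption | omega
    · have h3 := hv.1 i
      have h4 := hv.1 j
      have h5 := h1 i
      have h6 := h1 j
      have := i.2
      have := j.2
      have h7 : (i : ℕ) ≤ j → shift v S i ≤ shift v S j := fun hij => h2 (Fin.le_def.mpr hij)
      simp only [residue, cyclicKey, shift, he, if_true] at *
      by_contra hj
      simp only [hj, if_false] at *
      split_ifs at * <;> omega
  · intro h
    refine ⟨fun i => ?_, fun i j hij => ?_⟩
    · have h1 := hv.1 i
      have h2 := h none (some i)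
      have h3 := h (some i) none
      have := i.2
      simp only [residue, cyclicKey, shift] at *
      by_cases hn : none ∈ S <;> by_cases hi : some i ∈ S <;>
        simp only [hn, hi, if_true, if_false, forall_const, imp_false] at * <;>
        split_ifs at * <;> omega
    · have h1 := hv.2 hij
      have h2 := h (some i) (some j)
      have h3 : (i : ℕ) ≤ j := hij
      simp only [residue, cyclicKey, shift] at *
      by_cases hi : some i ∈ S <;> by_cases hj : some j ∈ S <;>
        simp only [hi, hj, if_true, if_false, forall_const, imp_false] at * <;>
        split_ifs at * <;> omega

theorem exists_shift_eq {n : ℕ} {v w : Fin n → ℤ} (h : Adj v w) :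
    ∃ S, S ≠ Finset.univ ∧ shift v S = w := by
  by_cases hvw : w = v
  · refine ⟨∅, ?_, by rw [shift_empty, hvw]⟩
    exact (Finset.univ_nonempty (α := Option (Fin n))).ne_empty.symm
  · rcases h with ⟨h1, h2⟩ | ⟨h1, h2⟩
    · refine ⟨Finset.univ.filter fun x => ∃ i, x = some i ∧ w i = v i + 1, fun h => ?_,
        funext fun i => ?_⟩
      · simpa using Finset.eq_univ_iff_forall.mp h none
      · have h3 : v i ≤ w i := h1 i
        have h4 : w i ≤ v i + 1 := h2 i
        simp only [shift, Finset.mem_filter, Finset.mem_univ, true_and, Option.some.injEq,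
          exists_eq_left', reduceCtorEq, false_and, exists_false, if_false]
        split_ifs <;> omega
    -- For `w` below `v`, raise `none` (for which the condition is vacuous) and every coordinate
    -- that is not lowered.
    · refine ⟨Finset.univ.filter fun x => ∀ i, x = some i → w i = v i, fun h => hvw ?_,
        funext fun i => ?_⟩
      · funext i
        simpa using Finset.eq_univ_iff_forall.mp h (some i)
      · have h3 : w i ≤ v i := h1 i
        have h4 : v i ≤ w i + 1 := h2 i
        simp only [shift, Finset.mem_filter, Finset.mem_univ, true_and, Option.some.injEq,
          forall_eq', reduceCtorEq, false_imp_iff, implies_true, if_true]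
        split_ifs <;> omega

/-- The link of a vertex `v` is the reduced order complex of a product of chains, one for each
residue class of coordinates. -/
theorem link_iso_of_classes {k q : ℕ} (hk : 1 ≤ k) (hq : 1 ≤ q) {v : Fin (k - 1) → ℤ}
    (hv : v ∈ W k q) {ι : Type} [DecidableEq ι] (cls : Option (Fin (k - 1)) → ι)
    (hcls : ∀ e e', cls e = cls e' ↔ residue q v e = residue q v e') (m : ι → ℕ)
    (hm : ∀ c, (Finset.univ.filter fun e => cls e = c).card = m c) :
    ((T k q).link {v}).Iso (orderComplex (Proper (∀ c, Fin (m c + 1)))) := by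
  obtain ⟨Φ⟩ := exists_orderIso_classUpper (cyclicKey q v) (cyclicKey_injective q v) cls m hm
  have hW : ∀ S, shift v S ∈ W k q ↔ ClassUpper (cyclicKey q v) cls S := by
    intro S
    simp only [shift_mem_W hq hv, ClassUpper, hcls]
  have hbot : ClassUpper (cyclicKey q v) cls ∅ := fun _ _ _ _ h => by simp at h
  have htop : ClassUpper (cyclicKey q v) cls Finset.univ := fun _ _ _ _ _ => Finset.mem_univ _
  -- The empty and the full set both shift `v` to itself. They are the two bounds removed in the
  -- proper part.
  have hΦbot : Φ ⟨∅, hbot⟩ = ⊥ := by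
    rw [eq_bot_iff, ← Φ.apply_symm_apply ⊥]
    exact Φ.monotone (Finset.empty_subset _)
  have hΦtop : Φ ⟨Finset.univ, htop⟩ = ⊤ := by
    rw [eq_top_iff, ← Φ.apply_symm_apply ⊤]
    exact Φ.monotone (Finset.subset_univ _)
  have huniv : ∀ x : Proper (∀ c, Fin (m c + 1)), (Φ.symm x.1).1 ≠ Finset.univ := by
    intro x h
    refine x.2.2 ?_
    exact (Φ.apply_symm_apply x.1).symm.trans ((congrArg Φ (Subtype.ext h)).trans hΦtop)
  have hempty : ∀ x : Proper (∀ c, Fin (m c + 1)), (Φ.symm x.1).1 ≠ ∅ := by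
    intro x h
    refine x.2.1 ?_
    exact (Φ.apply_symm_apply x.1).symm.trans ((congrArg Φ (Subtype.ext h)).trans hΦbot)
  have hne : (∅ : Finset (Option (Fin (k - 1)))) ≠ Finset.univ :=
    (Finset.univ_nonempty (α := Option (Fin (k - 1)))).ne_empty.symm
  refine (link_isCliqueComplex hk hq hv).iso (orderComplex_isCliqueComplex _)
    (fun x _ => Adj.refl x) (fun x => Or.inl le_rfl) (fun x => shift v (Φ.symm x.1).1) ?_ ?_ ?_
  · intro x y hxy
    exact Subtype.ext (Φ.symm.injective (Subtype.ext (shift_injOn v (huniv x) (huniv y) hxy)))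
  · ext w
    constructor
    · rintro ⟨x, rfl⟩
      refine ⟨(hW _).mpr (Φ.symm x.1).2, fun h => ?_, ?_⟩
      · refine hempty x (shift_injOn v (huniv x) hne ?_)
        rw [shift_empty]
        exact h
      · have := (adj_shift v ∅ (Φ.symm x.1).1).mpr (Or.inl (Finset.empty_subset _))
        rwa [shift_empty] at this
    · rintro ⟨h1, h2, h3⟩
      obtain ⟨S, hS, rfl⟩ := exists_shift_eq h3
      have hS' := (hW S).mp h1
      refine ⟨⟨Φ ⟨S, hS'⟩, fun h => h2 ?_, fun h => hS ?_⟩, ?_⟩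
      · rw [← hΦbot] at h
        have h' : S = ∅ := congrArg Subtype.val (Φ.injective h)
        rw [h', shift_empty]
      · rw [← hΦtop] at h
        exact congrArg Subtype.val (Φ.injective h)
      · simp
  · intro x y
    rw [adj_shift]
    exact or_congr (Φ.symm.le_iff_le (x := x.1) (y := y.1)) (Φ.symm.le_iff_le (x := y.1) (y := x.1))

/-! ### Counting multichains -/

/-- The multisets of size `n` whose elements are pairwise comparable. -/
abbrev ChainSym (P : Type*) [PartialOrder P] (n : ℕ) : Type _ :=
  {s : Sym P n // ∀ x ∈ s, ∀ y ∈ s, x ≤ y ∨ y ≤ x}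

theorem exists_pairwise_le_list {P : Type*} [PartialOrder P] (s : Multiset P)
    (hs : ∀ x ∈ s, ∀ y ∈ s, x ≤ y ∨ y ≤ x) : 
    ∃ l : List P, l.Pairwise (· ≤ ·) ∧ (l : Multiset P) = s := by
  classical
  -- On pairwise comparable elements a linear extension agrees with the given order, so sorting by
  -- it sorts the multichain.
  let r : P → P → Prop := fun x y => toLinearExtension x ≤ toLinearExtension y
  have hinj : Function.Injective (toLinearExtension : P → LinearExtension P) := fun _ _ h => h
  have : IsTrans P r := ⟨fun _ _ _ h h' => le_trans h h'⟩
  have : Std.Antisymm r := ⟨fun _ _ h h' => hinj (le_antisymm h h')⟩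
  have : Std.Total r := ⟨fun x y => le_total (toLinearExtension x) (toLinearExtension y)⟩
  refine ⟨s.sort r, (s.pairwise_sort r).imp_of_mem ?_, s.sort_eq r⟩
  intro a b ha hb hab
  rw [Multiset.mem_sort] at ha hb
  rcases hs a ha b hb with h | h
  · exact h
  · exact (hinj (le_antisymm hab (toLinearExtension.monotone h))).le

/-- A multichain has a unique weakly increasing listing. The left side depends only on
comparability; the right side is multiplicative over products. -/
theorem card_chainSym (P : Type*) [PartialOrder P] (n : ℕ) :
    Nat.card (ChainSym P n) = Nat.card (Fin n →o P) := by
  symm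
  let f : (Fin n →o P) → ChainSym P n := fun g =>
    ⟨⟨(List.ofFn g : Multiset P), by simp⟩, by
      intro x hx y hy
      change x ∈ (List.ofFn g : Multiset P) at hx
      change y ∈ (List.ofFn g : Multiset P) at hy
      rw [Multiset.mem_coe, List.mem_ofFn] at hx hy
      obtain ⟨i, rfl⟩ := hx
      obtain ⟨j, rfl⟩ := hy
      exact (le_total i j).imp (fun h => g.monotone h) (fun h => g.monotone h)⟩
  refine Nat.card_congr (Equiv.ofBijective f ⟨fun g g' h => ?_, fun s => ?_⟩)
  · have h1 : (List.ofFn g : Multiset P) = (List.ofFn g' : Multiset P) :=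
      congrArg (fun s : ChainSym P n => (s.1 : Multiset P)) h
    have h2 : ∀ g : Fin n →o P, (List.ofFn g).Pairwise (· ≤ ·) := fun g =>
      List.pairwise_ofFn.mpr fun i j hij => g.monotone hij.le
    have h3 := List.Perm.eq_of_pairwise' (h2 g) (h2 g') (Multiset.coe_eq_coe.mp h1)
    exact OrderHom.ext _ _ (List.ofFn_injective h3)
  · obtain ⟨l, hl, hls⟩ := exists_pairwise_le_list (s.1 : Multiset P) s.2
    have hlen : l.length = n := by
      rw [← Multiset.coe_card, hls]
      exact s.1.2
    subst hlen
    refine ⟨⟨l.get, fun i j hij => ?_⟩, Subtype.ext (Subtype.ext ?_)⟩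
    · rcases hij.lt_or_eq with h | h
      · exact List.pairwise_iff_get.mp hl i j h
      · rw [h]
    · change ((List.ofFn l.get : List P) : Multiset P) = _
      rw [List.ofFn_get, hls]
      rfl

theorem card_orderHom_fin (n m : ℕ) : Nat.card (Fin n →o Fin (m + 1)) = (m + n).choose n := by
  rw [← card_chainSym]
  have : Nat.card (ChainSym (Fin (m + 1)) n) = Nat.card (Sym (Fin (m + 1)) n) :=
    Nat.card_congr (Equiv.subtypeUnivEquiv fun s x _ y _ => le_total x y)
  rw [this, Nat.card_eq_fintype_card, Sym.card_sym_eq_choose, Fintype.card_fin]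
  congr 1
  omega

theorem card_chainSym_productOfChains (l : List ℕ) (n : ℕ) :
    Nat.card (ChainSym (ProductOfChains l) n) =
      ((l : Multiset ℕ).map fun m => (m + n).choose n).prod := by
  rw [card_chainSym, Nat.card_congr OrderHom.piIso.toEquiv, Nat.card_pi]
  simp only [card_orderHom_fin]
  rw [Multiset.map_coe, Multiset.prod_coe, ← List.prod_ofFn]
  congr 1
  conv_rhs => rw [← List.ofFn_get l, List.map_ofFn]
  rfl

theorem comparable_of_not_proper {P : Type*} [PartialOrder P] [BoundedOrder P] {x : P}
    (h : ¬(x ≠ ⊥ ∧ x ≠ ⊤)) (y : P) : x ≤ y ∨ y ≤ x := by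
  by_cases hx : x = ⊥
  · simp [hx]
  · have : x = ⊤ := by tauto
    simp [this]

/-- A comparability preserving bijection of the proper parts of two bounded partially ordered
sets preserves the numbers of multichains. -/
theorem card_chainSym_congr {P Q : Type*} [PartialOrder P] [PartialOrder Q] [BoundedOrder P]
    [BoundedOrder Q] [Nontrivial P] [Nontrivial Q] (e : Proper P ≃ Proper Q)
    (he : ∀ x y, (x ≤ y ∨ y ≤ x) ↔ (e x ≤ e y ∨ e y ≤ e x)) (n : ℕ) :
    Nat.card (ChainSym P n) = Nat.card (ChainSym Q n) := by
  classical
  -- Match bottom with bottom and top with top; nontriviality keeps the two apart. Both are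
  -- comparable to everything, so the extension `G` of `e` still preserves comparability.
  let d : {x : P // ¬(x ≠ ⊥ ∧ x ≠ ⊤)} ≃ {x : Q // ¬(x ≠ ⊥ ∧ x ≠ ⊤)} :=
    { toFun := fun x => if x.1 = ⊥ then ⟨⊥, by simp⟩ else ⟨⊤, by simp⟩
      invFun := fun x => if x.1 = ⊥ then ⟨⊥, by simp⟩ else ⟨⊤, by simp⟩
      left_inv := by
        rintro ⟨x, hx⟩
        by_cases h : x = ⊥
        · simp [h]
        · have : x = ⊤ := by tauto
          simp [this]
      right_inv := by
        rintro ⟨x, hx⟩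
        by_cases h : x = ⊥
        · simp [h]
        · have : x = ⊤ := by tauto
          simp [this] }
  let G : P ≃ Q := (Equiv.sumCompl fun x : P => x ≠ ⊥ ∧ x ≠ ⊤).symm.trans
    ((Equiv.sumCongr e d).trans (Equiv.sumCompl fun x : Q => x ≠ ⊥ ∧ x ≠ ⊤))
  have hG1 : ∀ x (h : x ≠ ⊥ ∧ x ≠ ⊤), G x = (e ⟨x, h⟩).1 := by
    intro x h
    have : (Equiv.sumCompl fun x : P => x ≠ ⊥ ∧ x ≠ ⊤).symm x = Sum.inl ⟨x, h⟩ := by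
      rw [Equiv.symm_apply_eq]
      rfl
    simp only [G, Equiv.trans_apply]
    rw [this]
    rfl
  have hG2 : ∀ x (h : ¬(x ≠ ⊥ ∧ x ≠ ⊤)), G x = (d ⟨x, h⟩).1 := by
    intro x h
    have : (Equiv.sumCompl fun x : P => x ≠ ⊥ ∧ x ≠ ⊤).symm x = Sum.inr ⟨x, h⟩ := by
      rw [Equiv.symm_apply_eq]
      rfl
    simp only [G, Equiv.trans_apply]
    rw [this]
    rfl
  have hG : ∀ x y, (x ≤ y ∨ y ≤ x) ↔ (G x ≤ G y ∨ G y ≤ G x) := by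
    intro x y
    by_cases hx : x ≠ ⊥ ∧ x ≠ ⊤
    · by_cases hy : y ≠ ⊥ ∧ y ≠ ⊤
      · rw [hG1 x hx, hG1 y hy]
        exact he ⟨x, hx⟩ ⟨y, hy⟩
      · rw [hG2 y hy]
        exact iff_of_true (comparable_of_not_proper hy x).symm
          (comparable_of_not_proper (d ⟨y, hy⟩).2 _).symm
    · rw [hG2 x hx]
      exact iff_of_true (comparable_of_not_proper hx y) (comparable_of_not_proper (d ⟨x, hx⟩).2 _)
  refine Nat.card_congr ((Sym.equivCongr G).subtypeEquiv fun s => ?_)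
  change _ ↔ ∀ x ∈ Sym.map G s, ∀ y ∈ Sym.map G s, _
  simp only [Sym.mem_map, forall_exists_index, and_imp, forall_apply_eq_imp_iff₂, hG]

theorem exists_equiv_of_iso_orderComplex {P Q : Type*} [PartialOrder P] [PartialOrder Q]
    (h : (orderComplex P).Iso (orderComplex Q)) :
    ∃ e : P ≃ Q, ∀ x y, (x ≤ y ∨ y ≤ x) ↔ (e x ≤ e y ∨ e y ≤ e x) := by
  classical
  obtain ⟨f, hf⟩ := h
  have hP := (orderComplex_isCliqueComplex P).vertices_eq fun x _ => Or.inl le_rfl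
  have hQ := (orderComplex_isCliqueComplex Q).vertices_eq fun x _ => Or.inl le_rfl
  have hP' : ∀ x, x ∈ (orderComplex P).vertices := fun x => by rw [hP]; trivial
  have hQ' : ∀ x, x ∈ (orderComplex Q).vertices := fun x => by rw [hQ]; trivial
  refine ⟨(Equiv.subtypeUnivEquiv hP').symm.trans (f.trans (Equiv.subtypeUnivEquiv hQ')),
    fun x y => ?_⟩
  -- Two elements are comparable exactly when they span a face.
  have := hf {⟨x, hP' x⟩, ⟨y, hP' y⟩}
  rw [orderComplex_isCliqueComplex, orderComplex_isCliqueComplex] at this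
  simpa [or_comm] using this

/-! ### Recovering a partition from its multichain numbers -/

open Polynomial in
/-- The product of the polynomials `(X + 1) ⋯ (X + m)`, over all `m` in `s`, determines the
positive elements of `s`. -/
theorem eq_of_prod_choose_eq {s t : Multiset ℕ} (hs : ∀ m ∈ s, 0 < m) (ht : ∀ m ∈ t, 0 < m)
    (h : ∀ n, (s.map fun m => (m + n).choose n).prod = (t.map fun m => (m + n).choose n).prod) :
    s = t := by
  -- `A s` is the multiset of roots, `R s` the monic polynomial with these roots, and `c s` the
  -- product of factorials relating `R s` to the product of binomials.
  let A : Multiset ℕ → Multiset ℚ := fun s =>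
    s.bind fun m => (Multiset.range m).map fun j : ℕ => -((j : ℚ) + 1)
  let R : Multiset ℕ → ℚ[X] := fun s => ((A s).map fun a => X - C a).prod
  let c : Multiset ℕ → ℚ := fun s => (s.map fun m => (m.factorial : ℚ)).prod
  have hc : ∀ s, c s ≠ 0 := by
    intro s
    refine Multiset.prod_ne_zero fun h => ?_
    obtain ⟨m, -, hm⟩ := Multiset.mem_map.mp h
    exact Nat.factorial_ne_zero m (by exact_mod_cast hm)
  have hfac : ∀ m n : ℕ, ((Multiset.range m).map fun j : ℕ => (n : ℚ) + (j + 1)).prod =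
      m.factorial * ((m + n).choose n : ℕ) := by
    intro m n
    induction m with
    | zero => simp
    | succ m ih =>
      rw [Multiset.range_succ, Multiset.map_cons, Multiset.prod_cons, ih]
      have h1 := Nat.choose_mul_succ_eq (m + n) n
      rw [show m + n + 1 - n = m + 1 by omega, show m + n + 1 = m + 1 + n by omega] at h1
      have h2 : ((m + n).choose n : ℚ) * (m + 1 + n) = (m + 1 + n).choose n * (m + 1) := by
        exact_mod_cast h1
      rw [Nat.factorial_succ]
      push_cast
      linear_combination (m.factorial : ℚ) * h2
  have heval : ∀ (s : Multiset ℕ) (n : ℕ), (R s).eval (n : ℚ) =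
      c s * ((s.map fun m => (m + n).choose n).prod : ℕ) := by
    intro s n
    induction s using Multiset.induction with
    | empty => simp [R, A, c]
    | cons m s ih =>
      have h1 : R (m ::ₘ s) =
          ((Multiset.range m).map fun j : ℕ => X - C (-((j : ℚ) + 1))).prod * R s := by
        simp [R, A]
      have h2 : c (m ::ₘ s) = m.factorial * c s := by simp [c]
      rw [h1, eval_mul, ih, h2, eval_multiset_prod, Multiset.map_map]
      have h3 : (fun j : ℕ => eval (n : ℚ) (X - C (-((j : ℚ) + 1)))) =
          fun j : ℕ => (n : ℚ) + (j + 1) := by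
        funext j
        simp only [eval_sub, eval_X, eval_C]
        ring
      change (Multiset.map (fun j : ℕ => eval (n : ℚ) (X - C (-((j : ℚ) + 1)))) _).prod * _ = _
      rw [h3, hfac, Multiset.map_cons, Multiset.prod_cons]
      push_cast
      ring
  have hpoly : C (c t) * R s = C (c s) * R t := by
    refine eq_of_infinite_eval_eq _ _ ((Set.infinite_range_of_injective
      (Nat.cast_injective (R := ℚ))).mono ?_)
    rintro _ ⟨n, rfl⟩
    simp only [Set.mem_ofPred_eq, eval_mul, eval_C, heval, h n]
    ring
  have hroots : A s = A t := by
    have := congrArg Polynomial.roots hpoly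
    rwa [roots_C_mul _ (hc t), roots_C_mul _ (hc s), roots_multiset_prod_X_sub_C,
      roots_multiset_prod_X_sub_C] at this
  -- The factor (X + 1) ⋯ (X + m) has the root -(j+1), once, exactly when `j < m`.
  have hcount : ∀ (s : Multiset ℕ) (j : ℕ), (A s).count (-((j : ℚ) + 1)) = s.countP (j < ·) := by
    intro s j
    have hinj : Function.Injective fun j : ℕ => -((j : ℚ) + 1) := by
      intro a b hab
      simpa using hab
    induction s using Multiset.induction with
    | empty => simp [A]
    | cons m s ih =>
      have h1 : A (m ::ₘ s) = ((Multiset.range m).map fun j : ℕ => -((j : ℚ) + 1)) + A s := by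
        simp [A]
      rw [h1, Multiset.count_add, ih, Multiset.countP_cons, add_comm]
      congr 1
      rw [Multiset.count_map_eq_count' (fun j : ℕ => -((j : ℚ) + 1)) _ hinj,
        Multiset.count_eq_of_nodup (Multiset.nodup_range m)]
      simp
  have hcount' : ∀ (s : Multiset ℕ) (j : ℕ),
      s.countP (j < ·) = s.count (j + 1) + s.countP (j + 1 < ·) := by
    intro s j
    induction s using Multiset.induction with
    | empty => simp
    | cons m s ih =>
      simp only [Multiset.countP_cons, Multiset.count_cons, ih]
      split_ifs <;> omega
  ext j
  rcases j with _ | j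
  · rw [Multiset.count_eq_zero_of_notMem fun h => (hs 0 h).ne rfl,
      Multiset.count_eq_zero_of_notMem fun h => (ht 0 h).ne rfl]
  · have h1 := hcount' s j
    have h2 := hcount' t j
    rw [← hcount, ← hcount] at h1 h2
    rw [hroots] at h1
    omega

/-! ### Partitions and vertex links -/

theorem sortedParts_coe {k : ℕ} (p : k.Partition) : (sortedParts p : Multiset ℕ) = p.parts :=
  Multiset.sort_eq _ _

theorem nontrivial_productOfChains {k : ℕ} (hk : 1 ≤ k) (p : k.Partition) :
    Nontrivial (ProductOfChains (sortedParts p)) := by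
  have hne : p.parts ≠ 0 := by
    intro h
    have := p.parts_sum
    rw [h, Multiset.sum_zero] at this
    omega
  rw [← sortedParts_coe] at hne
  have hlen : 0 < (sortedParts p).length := by
    rw [List.length_pos_iff]
    rintro h
    simp [h] at hne
  have hpos : 0 < (sortedParts p).get ⟨0, hlen⟩ := by
    refine p.parts_pos ?_
    rw [← sortedParts_coe]
    exact List.get_mem _ _
  refine ⟨⊥, ⊤, fun h => ?_⟩
  have := congrArg Fin.val (congrFun h ⟨0, hlen⟩)
  change 0 = (sortedParts p).get ⟨0, hlen⟩ at this
  omega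

/-- The complexes `K_λ` of different partitions are not combinatorially equivalent. -/
theorem K_iso_injective {k : ℕ} (hk : 1 ≤ k) {p p' : k.Partition} (h : (K p).Iso (K p')) :
    p = p' := by
  obtain ⟨e, he⟩ := exists_equiv_of_iso_orderComplex h
  have := nontrivial_productOfChains hk p
  have := nontrivial_productOfChains hk p'
  refine Nat.Partition.ext (eq_of_prod_choose_eq (fun m hm => p.parts_pos hm)
    (fun m hm => p'.parts_pos hm) fun n => ?_)
  have := card_chainSym_congr e he n
  rwa [card_chainSym_productOfChains, card_chainSym_productOfChains, sortedParts_coe,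
    sortedParts_coe] at this

theorem count_map_univ {α γ : Type*} [Fintype α] [DecidableEq γ] (f : α → γ) (c : γ) :
    (Finset.univ.val.map f).count c = Fintype.card {a // f a = c} := by
  rw [Multiset.count_map, Fintype.card_subtype, Finset.card_def, Finset.filter_val]
  simp only [eq_comm]

theorem exists_equiv_of_map_univ_eq {α β γ : Type*} [Fintype α] [Fintype β] [DecidableEq γ]
    (f : α → γ) (g : β → γ) (h : Finset.univ.val.map f = Finset.univ.val.map g) :
    ∃ e : α ≃ β, ∀ a, g (e a) = f a := by
  have E : ∀ c, Nonempty ({a // f a = c} ≃ {b // g b = c}) := fun c =>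
    Fintype.card_eq.mp (by rw [← count_map_univ, ← count_map_univ, h])
  exact ⟨Equiv.ofFiberEquiv fun c => (E c).some, fun a => Equiv.ofFiberEquiv_map _ a⟩

/-- The link of every vertex is one of the complexes `K_λ`, where `λ` has at most `q` parts. -/
theorem exists_link_iso_K {k q : ℕ} (hk : 1 ≤ k) (hq : 1 ≤ q) {v : Fin (k - 1) → ℤ}
    (hv : v ∈ W k q) :
    ∃ p : k.Partition, p.parts.card ≤ q ∧ ((T k q).link {v}).Iso (K p) := by
  classical
  let R : Finset ℤ := Finset.univ.image (residue q v)
  let fib : ℤ → ℕ := fun c => (Finset.univ.filter fun e => residue q v e = c).card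
  have hsum : (R.val.map fib).sum = k := by
    change ∑ c ∈ R, fib c = k
    rw [← Finset.card_eq_sum_card_image, Finset.card_univ, Fintype.card_option, Fintype.card_fin]
    omega
  let p : k.Partition :=
    { parts := R.val.map fib
      parts_pos := by
        intro i hi
        obtain ⟨c, hc, rfl⟩ := Multiset.mem_map.mp hi
        obtain ⟨e, he, rfl⟩ := Finset.mem_image.mp (Finset.mem_def.mpr hc)
        exact Finset.card_pos.mpr ⟨e, by simp⟩
      parts_sum := hsum }
  refine ⟨p, ?_, ?_⟩
  · have hsub : R ⊆ Finset.Ico 0 (q : ℤ) := by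
      intro c hc
      obtain ⟨e, -, rfl⟩ := Finset.mem_image.mp hc
      rw [Finset.mem_Ico]
      rcases e with _ | i
      · simp only [residue]
        omega
      · have := hv.1 i
        simp only [residue]
        split_ifs <;> omega
    have := Finset.card_le_card hsub
    simpa [p] using this
  -- The residues that occur must be indexed by positions in the sorted list of parts. Both index
  -- sets carry the same multiset of sizes, which yields a size-preserving bijection.
  · have hmap : Finset.univ.val.map (sortedParts p).get =
        Finset.univ.val.map fun c : {c // c ∈ R} => fib c.1 := by
      rw [Fin.univ_val_map, List.ofFn_get, sortedParts_coe]
      change R.val.map fib = _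
      exact (Multiset.attach_map_val' R.val fib).symm
    obtain ⟨e, he⟩ := exists_equiv_of_map_univ_eq _ _ hmap
    let cls : Option (Fin (k - 1)) → Fin (sortedParts p).length := fun x =>
      e.symm ⟨residue q v x, Finset.mem_image_of_mem _ (Finset.mem_univ _)⟩
    refine link_iso_of_classes hk hq hv cls (fun x y => ?_) (sortedParts p).get (fun c => ?_)
    · simp only [cls, e.symm.injective.eq_iff, Subtype.mk.injEq]
    · rw [← he c]
      simp only [cls, Equiv.symm_apply_eq, Subtype.ext_iff, fib]

/-- Every complex `K_λ`, where `λ` has at most `q` parts, is the link of a vertex. -/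
theorem exists_vertex_link_iso_K {k q : ℕ} (hk : 1 ≤ k) (hq : 1 ≤ q) (p : k.Partition)
    (hp : p.parts.card ≤ q) : ∃ v ∈ W k q, ((T k q).link {v}).Iso (K p) := by
  classical
  obtain ⟨n, rfl⟩ : ∃ n, k = n + 1 := ⟨k - 1, by omega⟩
  have hlen : (sortedParts p).length ≤ q := by
    rwa [← Multiset.coe_card, sortedParts_coe]
  have hpos : ∀ c, 0 < (sortedParts p).get c := fun c => p.parts_pos (by
    rw [← sortedParts_coe]
    exact List.get_mem _ _)
  have hcard : Fintype.card (Fin (n + 1)) =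
      Fintype.card (Σ c : Fin (sortedParts p).length, Fin ((sortedParts p).get c)) := by
    rw [Fintype.card_sigma]
    simp only [Fintype.card_fin]
    rw [← List.sum_ofFn, List.ofFn_get, ← Multiset.sum_coe, sortedParts_coe, p.parts_sum]
  let E := Fintype.equivOfCardEq hcard
  -- A labelling of `n + 1` places that uses each label `c` exactly λ_c times; `x` is its increasing
  -- rearrangement.
  let x₀ : Fin (n + 1) → Fin (sortedParts p).length := fun a => (E a).1
  let x := x₀ ∘ Tuple.sort x₀
  have hx : Monotone x := Tuple.monotone_sort x₀
  let ε : Option (Fin n) ≃ Σ c : Fin (sortedParts p).length, Fin ((sortedParts p).get c) :=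
    (finSuccEquiv n).symm.trans ((Tuple.sort x₀).trans E)
  let cls : Option (Fin n) → Fin (sortedParts p).length := fun e => (ε e).1
  have hnone : cls none = x 0 := rfl
  have hsome : ∀ i, cls (some i) = x i.succ := fun i => rfl
  -- Label 0 is used because its part is positive, so the first place can play the additional
  -- coordinate of value 0.
  have hx0 : (x 0 : ℕ) = 0 := by
    have hl : 0 < (sortedParts p).length := (Nat.zero_le _).trans_lt (x 0).2
    have h1 : x ((Tuple.sort x₀).symm (E.symm ⟨⟨0, hl⟩, ⟨0, hpos _⟩⟩)) = ⟨0, hl⟩ := by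
      simp [x, x₀]
    have h2 := hx (Fin.zero_le ((Tuple.sort x₀).symm (E.symm ⟨⟨0, hl⟩, ⟨0, hpos _⟩⟩)))
    rw [h1] at h2
    exact Nat.le_zero.mp h2
  -- The remaining labels are the coordinates. They are below the number of parts, hence below `q`,
  -- so each is its own residue.
  let v : Fin (n + 1 - 1) → ℤ := fun i => ((x (Fin.succ i) : ℕ) : ℤ)
  have hvq : ∀ i, 0 ≤ v i ∧ v i < (q : ℤ) := fun i => by
    have := (x (Fin.succ i)).2
    simp only [v]
    omega
  have hv : v ∈ W (n + 1) q := by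
    refine ⟨fun i => ⟨(hvq i).1, (hvq i).2.le⟩, fun i j hij => ?_⟩
    have h1 : x (Fin.succ i) ≤ x (Fin.succ j) := hx (Fin.succ_le_succ_iff.mpr hij)
    have h2 : (x (Fin.succ i) : ℕ) ≤ x (Fin.succ j) := h1
    simp only [v]
    omega
  have hres : ∀ e, residue q v e = ((cls e : ℕ) : ℤ) := by
    rintro (_ | i)
    · rw [hnone, hx0]
      rfl
    · simp only [residue]
      rw [if_neg (hvq i).2.ne]
      rfl
  refine ⟨v, hv, link_iso_of_classes hk hq hv cls (fun e e' => ?_) (sortedParts p).get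
    (fun c => ?_)⟩
  · rw [hres, hres, Nat.cast_inj, Fin.val_inj]
  · have h1 : {e // cls e = c} ≃ Fin ((sortedParts p).get c) :=
      (ε.subtypeEquiv fun e => Iff.rfl).trans (Equiv.sigmaSubtype c)
    have h2 := Fintype.card_congr h1
    rw [Fintype.card_fin, Fintype.card_subtype] at h2
    exact h2

theorem one_le_card_parts {k : ℕ} (hk : 1 ≤ k) (p : k.Partition) : 1 ≤ p.parts.card := by
  rw [Nat.one_le_iff_ne_zero, Ne, Multiset.card_eq_zero]
  intro h
  have := p.parts_sum
  rw [h, Multiset.sum_zero] at this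
  omega

theorem card_parts_le {k : ℕ} (p : k.Partition) : p.parts.card ≤ k := by
  have h := Multiset.card_nsmul_le_sum (s := p.parts) (a := 1) fun x hx => p.parts_pos hx
  rwa [p.parts_sum, smul_eq_mul, mul_one] at h

/-- Sending λ to the type of a link equivalent to `K_λ` is injective by `K_iso_injective` and
surjective by `exists_link_iso_K`. -/
theorem numLinkTypes_eq {k q : ℕ} (hk : 1 ≤ k) (hq : 1 ≤ q) :
    numLinkTypes k q = {p : k.Partition | p.parts.card ≤ q}.ncard := by
  choose v hv hiso using fun p : {p : k.Partition // p.parts.card ≤ q} =>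
    exists_vertex_link_iso_K hk hq p.1 p.2
  rw [numLinkTypes, vertices_T hk hq]
  symm
  refine Set.ncard_congr (fun p hp => Quotient.mk _ ((T k q).link {v ⟨p, hp⟩})) ?_ ?_ ?_
  · intro p hp
    exact ⟨_, hv ⟨p, hp⟩, rfl⟩
  · intro p p' hp hp' h
    exact K_iso_injective hk (((hiso ⟨p, hp⟩).symm.trans (Quotient.exact h)).trans
      (hiso ⟨p', hp'⟩))
  · rintro _ ⟨w, hw, rfl⟩
    obtain ⟨p, hp, h⟩ := exists_link_iso_K hk hq hw
    exact ⟨p, hp, Quotient.sound ((hiso ⟨p, hp⟩).trans h.symm)⟩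

theorem ncard_card_parts_le {k : ℕ} (hk : 1 ≤ k) (q : ℕ) :
    {p : k.Partition | p.parts.card ≤ q}.ncard = ∑ s ∈ Finset.Icc 1 q, (Par k s).ncard := by
  classical
  have h1 : {p : k.Partition | p.parts.card ≤ q} =
      ↑(Finset.univ.filter fun p : k.Partition => p.parts.card ≤ q) := by
    ext p
    simp
  have h2 : ∀ s, Par k s = ↑(Finset.univ.filter fun p : k.Partition => p.parts.card = s) := by
    intro s
    ext p
    simp [Par]
  simp only [h1, h2, Set.ncard_coe_finset]
  rw [Finset.card_eq_sum_card_fiberwise (f := fun p => p.parts.card) (t := Finset.Icc 1 q)]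
  · refine Finset.sum_congr rfl fun s hs => ?_
    congr 1
    ext p
    have := (Finset.mem_Icc.mp hs).2
    simp only [Finset.mem_filter, Finset.mem_univ, true_and]
    omega
  · intro p hp
    simp only [Finset.coe_filter, Finset.mem_univ, true_and, Set.mem_ofPred_eq] at hp
    exact Finset.mem_coe.mpr (Finset.mem_Icc.mpr ⟨one_le_card_parts hk p, hp⟩)

end EdgewiseSubdivision

theorem mainTheorem6 (k q : ℕ) (hk : 1 ≤ k) (hq : 1 ≤ q) :
    (∀ v ∈ (EdgewiseSubdivision.T k q).vertices,
      ∃ s ∈ Finset.Icc 1 q, ∃ p ∈ EdgewiseSubdivision.Par k s,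
        ((EdgewiseSubdivision.T k q).link {v}).Iso (EdgewiseSubdivision.K p)) ∧
    (∀ s ∈ Finset.Icc 1 q, ∀ p ∈ EdgewiseSubdivision.Par k s,
      ∃ v ∈ (EdgewiseSubdivision.T k q).vertices,
        ((EdgewiseSubdivision.T k q).link {v}).Iso (EdgewiseSubdivision.K p)) ∧
    (k ≤ q → EdgewiseSubdivision.numLinkTypes k q = Nat.card k.Partition) ∧
    (q < k → EdgewiseSubdivision.numLinkTypes k q =
      ∑ s ∈ Finset.Icc 1 q, (EdgewiseSubdivision.Par k s).ncard) := by
  rw [EdgewiseSubdivision.vertices_T hk hq, EdgewiseSubdivision.numLinkTypes_eq hk hq]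
  refine ⟨fun v hv => ?_, fun s hs p hp => ?_, fun h => ?_, fun _ => ?_⟩
  · obtain ⟨p, hp, h⟩ := EdgewiseSubdivision.exists_link_iso_K hk hq hv
    exact ⟨_, Finset.mem_Icc.mpr ⟨EdgewiseSubdivision.one_le_card_parts hk p, hp⟩, p, rfl, h⟩
  · have hp' : p.parts.card = s := hp
    exact EdgewiseSubdivision.exists_vertex_link_iso_K hk hq p
      (hp'.trans_le (Finset.mem_Icc.mp hs).2)
  · rw [← Set.ncard_univ]
    congr 1
    ext p
    simpa using (EdgewiseSubdivision.card_parts_le p).trans h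
  · exact EdgewiseSubdivision.ncard_card_parts_le hk q
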